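/- Graphs here are finite and may have loops, semi-edges and multiple edges: every edge is either a normal edge, incident with two distinct vertices and adding $1$ to the degree of each; or a loop, incident with one vertex and adding $2$ to its degree; or a semi-edge, incident with one vertex and adding $1$ to its degree. A graph is simple if it has no loops, no semi-edges and no two distinct normal edges with the same pair of end vertices. It is cubic if every vertex has degree $3$. A perfect matching is a set $M$ of normal edges such that every vertex is incident with exactly one edge of $M$. A covering projection from a graph $H$ to a graph $G$ is a pair of surjective maps $f_V\colon V(H)\to V(G)$ and $f_E\colon E(H)\to E(G)$ such that $f_V$ preserves degrees; $f_E$ maps semi-edges to semi-edges and loops to loops; for every $e\in E(H)$ the vertices incident with $f_E(e)$ are exactly the images under $f_V$ of the vertices incident with $e$; and the pair is locally bijective on edge ends, that is, for every $w\in V(H)$ and every edge $e$ of $G$ incident with $f_V(w)$, the edges in $f_E^{-1}(e)$ have in total exactly one end at $w$ if $e$ is a normal edge or a semi-edge, and exactly two ends at $w$ if $e$ is a loop (a loop of $H$ at $w$ counts as two ends). If such a projection exists, $H$ is called a cover of $G$. **Lemma.** Let $G$ be a connected cubic graph without semi-edges that has no perfect matching. Then there is a connected simple graph $H$ that is a cover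 of $G$ and has no perfect matching. -/

import Mathlib

universe u v

/-- The shape of an edge on a vertex type: a semi-edge has one end, at the vertex `v`; a link has two
ends, given by an unordered pair (a loop if the two ends coincide, a normal edge otherwise). -/
inductive EdgeEnds (V : Type*) where
  | semi (v : V) : EdgeEnds V
  | link (s : Sym2 V) : EdgeEnds V

/-- A graph with vertices `V` and edges `E`; semi-edges, multiple loops and multiple normal edges
are allowed. Finiteness is imposed by `[Fintype V] [Fintype E]`. -/
structure Multigraph (V E : Type*) where
  ends : E → EdgeEnds V

namespace Multigraph

variable {V E W F : Type*}

def IsSemi (G : Multigraph V E) (e : E) : Prop := ∃ v, G.ends e = .semi v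

def IsLoop (G : Multigraph V E) (e : E) : Prop := ∃ v, G.ends e = .link s(v, v)

def IsNormal (G : Multigraph V E) (e : E) : Prop := ∃ u v, u ≠ v ∧ G.ends e = .link s(u, v)

/-- The edge `e` is incident with the vertex `v`. -/
def Inc (G : Multigraph V E) (e : E) (v : V) : Prop :=
  match G.ends e with
  | .semi u => u = v
  | .link s => v ∈ s

open scoped Classical in
/-- The number of ends of `e` at `v`: what `e` adds to the degree of `v`. It is `2` for a loop at
`v`, `1` for a normal edge or a semi-edge incident with `v`, and `0` if `e` is not incident
with `v`. -/
noncomputable def endCount (G : Multigraph V E) (e : E) (v : V) : ℕ :=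
  if G.Inc e v then (if G.IsLoop e then 2 else 1) else 0

noncomputable def degree [Fintype E] (G : Multigraph V E) (v : V) : ℕ := ∑ e, G.endCount e v

def IsCubic [Fintype E] (G : Multigraph V E) : Prop := ∀ v, G.degree v = 3

/-- No loops, no semi-edges and no multiple normal edges. -/
def IsSimple (G : Multigraph V E) : Prop :=
  (∀ e, ¬ G.IsLoop e) ∧ (∀ e, ¬ G.IsSemi e) ∧
    ∀ e e', G.IsNormal e → G.IsNormal e' → G.ends e = G.ends e' → e = e'

/-- The adjacency of distinct vertices by normal edges. -/
def adjGraph (G : Multigraph V E) : SimpleGraph V where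
  Adj u v := u ≠ v ∧ ∃ e, G.ends e = .link s(u, v)
  symm := ⟨fun u v ⟨h, e, he⟩ => ⟨h.symm, e, by rw [he, Sym2.eq_swap]⟩⟩
  loopless := ⟨fun _ h => h.1 rfl⟩

def Connected (G : Multigraph V E) : Prop := G.adjGraph.Connected

/-- A set of normal edges such that every vertex is incident with exactly one of them. -/
def IsPerfectMatching (G : Multigraph V E) (M : Set E) : Prop :=
  (∀ e ∈ M, G.IsNormal e) ∧ ∀ v, ∃! e, e ∈ M ∧ G.Inc e v

open scoped Classical in
/-- A covering projection from `G` to `H`.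

In `local_bij`, edges are counted by their ends, so a loop is present twice in the neighbourhood of
its vertex: at each vertex `w` over `v`, exactly one edge end lies over each normal edge and each
semi-edge at `v`, and exactly two edge ends lie over each loop at `v`. Hence the preimage of a loop
at `v` is a disjoint union of cycles (of length one, two or more) spanning the fibre of `v`. -/
structure IsCoveringProjection [Fintype F] [Fintype E] (G : Multigraph W F) (H : Multigraph V E)
    (fV : W → V) (fE : F → E) : Prop where
  surj_vertex : Function.Surjective fV
  surj_edge : Function.Surjective fE
  degree_eq : ∀ w, H.degree (fV w) = G.degree w
  map_semi : ∀ e, G.IsSemi e → H.IsSemi (fE e)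
  map_loop : ∀ e, G.IsLoop e → H.IsLoop (fE e)
  /-- The vertices incident with `fE e` are exactly the images of those incident with `e`. -/
  map_inc : ∀ e v, H.Inc (fE e) v ↔ ∃ w, G.Inc e w ∧ fV w = v
  local_bij : ∀ w e, ∑ e' with fE e' = e, G.endCount e' w = H.endCount e (fV w)

/-- `G` covers `H`. -/
def Covers [Fintype F] [Fintype E] (G : Multigraph W F) (H : Multigraph V E) : Prop :=
  ∃ fV fE, IsCoveringProjection G H fV fE

end Multigraph

/-! Lift `G` to one copy of itself (sheet `none`) together with gadgets, one per index, in which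
every edge translates `ι → ZMod 3` by its own basis vector. Let `R` consist of all loops and all but
one edge of each parallel class. Each `e ∈ R` has its lift on sheet `none` crossed with its lift at
`0` in its own gadget, so that these two lifts are the only edges leaving that gadget. In a cubic
graph, the edges of a cut and the matching edges of a cut both have the parity of a side; hence a
perfect matching contains both or neither edge of a 2-edge cut
(`IsPerfectMatching.mem_iff_mem_of_cut`). So the two crossed lifts act as one edge, and a perfect
matching of the cover would give one of `G` (`isPerfectMatching_of_gadgetCover`). Simplicity holds
because basis vectors are distinct and no two sum to zero, while sheet `none` keeps only edges
outside `R`. These still connect that sheet, so its component covers `G`. -/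

namespace Multigraph

variable {V E I ι : Type*}

/-! ### Oriented edges and the parity of cuts -/

section Links

variable {G : Multigraph V E} {s t : E → V}

lemma inc_iff_of_ends (h : ∀ e, G.ends e = .link s(s e, t e)) (e : E) (v : V) :
    G.Inc e v ↔ s e = v ∨ t e = v := by
  simp only [Inc, h, Sym2.mem_iff, eq_comm]

lemma isLoop_iff_of_ends (h : ∀ e, G.ends e = .link s(s e, t e)) (e : E) :
    G.IsLoop e ↔ s e = t e := by
  simp only [IsLoop, h, EdgeEnds.link.injEq, Sym2.eq_iff]
  constructor
  · rintro ⟨v, ⟨h1, h2⟩ | ⟨h1, h2⟩⟩ <;> exact h1.trans h2.symm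
  · intro h'
    exact ⟨t e, .inl ⟨h', rfl⟩⟩

lemma isNormal_iff_of_ends (h : ∀ e, G.ends e = .link s(s e, t e)) (e : E) :
    G.IsNormal e ↔ s e ≠ t e := by
  simp only [IsNormal, h, EdgeEnds.link.injEq, Sym2.eq_iff]
  constructor
  · rintro ⟨u, v, huv, ⟨rfl, rfl⟩ | ⟨rfl, rfl⟩⟩
    exacts [huv, huv.symm]
  · intro h'
    exact ⟨s e, t e, h', .inl ⟨rfl, rfl⟩⟩

open scoped Classical in
/-- In a graph without semi-edges the ends of an edge at `v` are counted by an orientation. -/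
lemma endCount_of_ends (h : ∀ e, G.ends e = .link s(s e, t e)) (e : E) (v : V) :
    G.endCount e v = (if s e = v then 1 else 0) + (if t e = v then 1 else 0) := by
  simp only [endCount, inc_iff_of_ends h, isLoop_iff_of_ends h]
  by_cases h1 : s e = v <;> by_cases h2 : t e = v <;> simp_all [eq_comm]

lemma not_isSemi_of_ends (h : ∀ e, G.ends e = .link s(s e, t e)) (e : E) : ¬ G.IsSemi e := by
  rintro ⟨v, hv⟩
  simp [h] at hv

lemma exists_orientation (hsemi : ∀ e, ¬ G.IsSemi e) :
    ∃ s t : E → V, ∀ e, G.ends e = .link s(s e, t e) := by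
  have : ∀ e, ∃ p : V × V, G.ends e = .link s(p.1, p.2) := by
    intro e
    cases h : G.ends e with
    | semi v => exact absurd ⟨v, h⟩ (hsemi e)
    | link z =>
      induction z with
      | _ x y => exact ⟨(x, y), rfl⟩
  choose p hp using this
  exact ⟨fun e => (p e).1, fun e => (p e).2, hp⟩

open scoped Classical in
/-- Counting, modulo two, the weights of the edge ends in a vertex set. -/
lemma sum_endCount_eq_sum_crossing [Fintype E] [Fintype V]
    (h : ∀ e, G.ends e = .link s(s e, t e)) (X : Finset V) (c : E → ZMod 2) :
    ∑ v ∈ X, ∑ e, c e * (G.endCount e v : ZMod 2) =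
      ∑ e with ¬ (s e ∈ X ↔ t e ∈ X), c e := by
  rw [Finset.sum_comm, Finset.sum_filter]
  refine Finset.sum_congr rfl fun e _ => ?_
  rw [← Finset.mul_sum]
  simp only [endCount_of_ends h, Nat.cast_add, Nat.cast_ite, Nat.cast_one, Nat.cast_zero,
    Finset.sum_add_distrib, Finset.sum_ite_eq]
  have h2 : (1 + 1 : ZMod 2) = 0 := rfl
  -- An edge with both ends in `X` is counted twice, hence vanishes modulo two.
  by_cases h3 : s e ∈ X <;> by_cases h4 : t e ∈ X <;> simp [h3, h4, h2]

open scoped Classical in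
/-- A perfect matching of a cubic graph uses both or none of the edges of a cut of size two. -/
lemma IsPerfectMatching.mem_iff_mem_of_cut [Fintype E] [Fintype V]
    (h : ∀ e, G.ends e = .link s(s e, t e)) (hcubic : G.IsCubic) {M : Set E}
    (hM : G.IsPerfectMatching M) (X : Finset V) {p q : E} (hpq : p ≠ q)
    (hcut : ∀ e, ¬ (s e ∈ X ↔ t e ∈ X) ↔ e = p ∨ e = q) : p ∈ M ↔ q ∈ M := by
  have hfilter : (Finset.univ.filter fun e => ¬ (s e ∈ X ↔ t e ∈ X)) = {p, q} := by
    ext e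
    simp [hcut]
  have h2 : (1 + 1 : ZMod 2) = 0 := rfl
  -- Both weightings give every vertex the value one (degree three, and one matching edge), so their
  -- cut sums agree.
  have hall := sum_endCount_eq_sum_crossing h X (fun _ => 1)
  have hmat := sum_endCount_eq_sum_crossing h X (fun e => if e ∈ M then 1 else 0)
  rw [hfilter, Finset.sum_pair hpq] at hall hmat
  have hdeg : ∀ v, ∑ e, (1 : ZMod 2) * (G.endCount e v : ZMod 2) = 1 := by
    intro v
    have := hcubic v
    simp only [one_mul, ← Nat.cast_sum]
    rw [degree] at this
    rw [this]
    rfl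
  have hone : ∀ v, ∑ e, (if e ∈ M then 1 else 0) * (G.endCount e v : ZMod 2) = 1 := by
    intro v
    obtain ⟨e, ⟨heM, hev⟩, huniq⟩ := hM.2 v
    rw [Finset.sum_eq_single e]
    · have hl : ¬ G.IsLoop e := by
        rw [isLoop_iff_of_ends h]
        exact (isNormal_iff_of_ends h e).1 (hM.1 e heM)
      simp [endCount, heM, hev, hl]
    · intro f _ hf
      by_cases hfM : f ∈ M
      · have : ¬ G.Inc f v := fun hi => hf (huniq f ⟨hfM, hi⟩)
        simp [endCount, this]
      · simp [hfM]
    · simp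
  simp only [hdeg, hone] at hall hmat
  rw [hall, h2] at hmat
  clear hall hdeg hone hfilter hcut
  by_cases hp : p ∈ M <;> by_cases hq : q ∈ M <;> simp [hp, hq] at hmat ⊢

end Links

/-! ### Components of permutation voltage covers -/

section Lift

variable (s t : E → V) (σ : E → Equiv.Perm I) (K : Set (V × I))

/-- The part on the vertex set `K` of the cover with permutation voltages `σ`. -/
def voltageCover (hK : ∀ e i, (s e, i) ∈ K ↔ (t e, σ e i) ∈ K) :
    Multigraph K {x : E × I // (s x.1, x.2) ∈ K} where
  ends x := .link s(⟨(s x.1.1, x.1.2), x.2⟩, ⟨(t x.1.1, σ x.1.1 x.1.2), (hK _ _).1 x.2⟩)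

variable {s t σ K} (hK : ∀ e i, (s e, i) ∈ K ↔ (t e, σ e i) ∈ K)

lemma voltageCover_ends (x : {x : E × I // (s x.1, x.2) ∈ K}) :
    (voltageCover s t σ K hK).ends x =
      .link s(⟨(s x.1.1, x.1.2), x.2⟩, ⟨(t x.1.1, σ x.1.1 x.1.2), (hK _ _).1 x.2⟩) :=
  rfl

open scoped Classical in
lemma voltageCover_isCoveringProjection [Fintype E]
    [Fintype {x : E × I // (s x.1, x.2) ∈ K}] {G : Multigraph V E}
    (h : ∀ e, G.ends e = .link s(s e, t e)) (i₀ : I) (hbase : ∀ v, (v, i₀) ∈ K) :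
    IsCoveringProjection (voltageCover s t σ K hK) G (fun w => w.1.1) (fun x => x.1.1) := by
  have hends := voltageCover_ends hK
  have hlocal : ∀ (w : K) e, ∑ e' : {x : E × I // (s x.1, x.2) ∈ K} with e'.1.1 = e,
      (voltageCover s t σ K hK).endCount e' w = G.endCount e w.1.1 := by
    rintro ⟨⟨v, j⟩, hw⟩ e
    simp only [endCount_of_ends hends, endCount_of_ends h, Finset.sum_add_distrib]
    congr 1
    · split_ifs with hv
      · subst hv
        rw [Finset.sum_eq_single ⟨(e, j), hw⟩]
        · simp
        · rintro ⟨⟨f, i⟩, hf⟩ hfe hne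
          simp_all
        · simp
      · refine Finset.sum_eq_zero ?_
        rintro ⟨⟨f, i⟩, hf⟩ hfe
        simp_all
    · split_ifs with hv
      · subst hv
        -- Lifts are indexed by the sheet of their source, so the one ending on sheet `j` starts on
        -- `(σ e).symm j`.
        rw [Finset.sum_eq_single ⟨(e, (σ e).symm j), (hK _ _).2 (by simpa using hw)⟩]
        · simp
        · rintro ⟨⟨f, i⟩, hf⟩ hfe hne
          simp only [Finset.mem_filter, Finset.mem_univ, true_and] at hfe
          subst hfe
          simp only [ne_eq, Subtype.mk.injEq, Prod.mk.injEq, true_and, Equiv.eq_symm_apply] at hne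
          simp [hne]
        · simp
      · refine Finset.sum_eq_zero ?_
        rintro ⟨⟨f, i⟩, hf⟩ hfe
        simp_all
  refine ⟨fun v => ⟨⟨(v, i₀), hbase v⟩, rfl⟩, fun e => ⟨⟨(e, i₀), hbase _⟩, rfl⟩, ?_, ?_, ?_, ?_,
    hlocal⟩
  · intro w
    simp only [degree, ← hlocal w]
    exact Finset.sum_fiberwise _ _ _
  · intro e he
    exact absurd he (not_isSemi_of_ends hends e)
  · intro e he
    rw [isLoop_iff_of_ends hends] at he
    rw [isLoop_iff_of_ends h]
    exact congrArg (fun w : K => w.1.1) he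
  · intro e v
    rw [inc_iff_of_ends h]
    simp only [inc_iff_of_ends hends]
    constructor
    · rintro (hv | hv)
      · exact ⟨_, .inl rfl, hv⟩
      · exact ⟨_, .inr rfl, hv⟩
    · rintro ⟨w, rfl | rfl, hw⟩
      exacts [.inl hw, .inr hw]

/-- Conditions on the voltages under which the cover has no loops and no multiple edges. -/
lemma voltageCover_isSimple (hloop : ∀ e i, s e = t e → σ e i ≠ i)
    (hpar : ∀ e f i, s e = s f → t e = t f → σ e i = σ f i → e = f)
    (hanti : ∀ e f i, s e = t f → t e = s f → σ f (σ e i) ≠ i) :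
    (voltageCover s t σ K hK).IsSimple := by
  have hends := voltageCover_ends hK
  refine ⟨?_, not_isSemi_of_ends hends, ?_⟩
  · rintro ⟨⟨e, i⟩, he⟩ hl
    rw [isLoop_iff_of_ends hends] at hl
    simp only [Subtype.mk.injEq, Prod.mk.injEq] at hl
    exact hloop e i hl.1 hl.2.symm
  · rintro ⟨⟨e, i⟩, he⟩ ⟨⟨f, j⟩, hf⟩ - - hef
    simp only [hends, EdgeEnds.link.injEq, Sym2.eq_iff, Subtype.mk.injEq, Prod.mk.injEq] at hef ⊢
    rcases hef with ⟨⟨h1, h2⟩, h3, h4⟩ | ⟨⟨h1, h2⟩, h3, h4⟩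
    · subst h2
      exact ⟨hpar e f i h1 h3 h4, rfl⟩
    · rw [← h4] at h2
      exact absurd h2.symm (hanti e f i h1 h3)

/-- The vertices of the cover with permutation voltages `σ`, adjacent along its edges. -/
def voltageGraph (s t : E → V) (σ : E → Equiv.Perm I) : SimpleGraph (V × I) :=
  SimpleGraph.fromRel fun a b => ∃ e i, a = (s e, i) ∧ b = (t e, σ e i)

lemma mem_supp_iff_of_voltageGraph (C : (voltageGraph s t σ).ConnectedComponent) (e : E) (i : I) :
    (s e, i) ∈ C.supp ↔ (t e, σ e i) ∈ C.supp := by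
  by_cases hne : (s e, i) = (t e, σ e i)
  · rw [hne]
  · exact SimpleGraph.ConnectedComponent.mem_supp_congr_adj C ⟨hne, .inl ⟨e, i, rfl, rfl⟩⟩

lemma voltageCover_connected (C : (voltageGraph s t σ).ConnectedComponent) :
    (voltageCover s t σ C.supp (mem_supp_iff_of_voltageGraph C)).Connected := by
  refine C.connected_toSimpleGraph.mono ?_
  rintro ⟨a, ha⟩ ⟨b, hb⟩ hab
  have hab' : (voltageGraph s t σ).Adj a b := hab
  obtain ⟨hne, ⟨e, i, rfl, rfl⟩ | ⟨e, i, rfl, rfl⟩⟩ := hab'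
  · exact ⟨by simpa using hne, ⟨(e, i), ha⟩, rfl⟩
  · exact ⟨by simpa using hne, ⟨(e, i), hb⟩, by rw [voltageCover_ends, Sym2.eq_swap]⟩

end Lift

/-! ### The gadget voltages -/

section Voltage

variable [DecidableEq ι] (n : E ↪ ι) (R : Set E)

/-- The translation attached to an edge. -/
def shift (e : E) : ι → ZMod 3 := Pi.single (n e) 1

lemma shift_ne_zero (e : E) : shift n e ≠ 0 := by
  simp [shift]

lemma shift_injective : Function.Injective (shift n) := by
  intro e f h
  have := congrFun h (n e)
  by_contra hne
  simp [shift, hne] at this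

/-- This is where modulus three matters: modulo two the case `e = f` would fail, and a loop would
lift to a pair of parallel edges. -/
lemma shift_add_shift_ne_zero (e f : E) : shift n e + shift n f ≠ 0 := by
  intro h
  have := congrFun h (n e)
  by_cases hne : e = f
  · subst hne
    simp only [shift, Pi.add_apply, Pi.single_eq_same, Pi.zero_apply] at this
    exact absurd this (by decide)
  · simp [shift, hne] at this

open scoped Classical in
/-- Sheet `none` is a copy of the base graph, and for each index there is a gadget with sheets
`ι → ZMod 3`. An edge in `R` is rerouted from sheet `none` through its own gadget. -/
noncomputable def gadgetVoltage (e : E) : Equiv.Perm (Option (ι × (ι → ZMod 3))) :=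
  (if e ∈ R then Equiv.swap none (some (n e, 0)) else 1).trans
    (Equiv.optionCongr (Equiv.prodCongr (Equiv.refl ι) (Equiv.addRight (shift n e))))

variable {n R}

lemma gadgetVoltage_none_of_mem {e : E} (he : e ∈ R) :
    gadgetVoltage n R e none = some (n e, shift n e) := by
  simp [gadgetVoltage, he]

lemma gadgetVoltage_none_of_notMem {e : E} (he : e ∉ R) :
    gadgetVoltage n R e none = none := by
  simp [gadgetVoltage, he]

lemma gadgetVoltage_some_of_mem {e : E} (he : e ∈ R) :
    gadgetVoltage n R e (some (n e, 0)) = none := by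
  simp [gadgetVoltage, he]

lemma gadgetVoltage_some {e : E} {g : ι} {a : ι → ZMod 3} (h : ¬ (e ∈ R ∧ g = n e ∧ a = 0)) :
    gadgetVoltage n R e (some (g, a)) = some (g, a + shift n e) := by
  by_cases he : e ∈ R
  · have : some (g, a) ≠ some (n e, (0 : ι → ZMod 3)) := by
      simp only [ne_eq, Option.some.injEq, Prod.mk.injEq]
      exact fun h' => h ⟨he, h'⟩
    simp [gadgetVoltage, he, Equiv.swap_apply_of_ne_of_ne, this]
  · simp [gadgetVoltage, he]

lemma gadgetVoltage_ne_self {e : E} (he : e ∈ R) (i : Option (ι × (ι → ZMod 3))) :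
    gadgetVoltage n R e i ≠ i := by
  rcases i with _ | ⟨g, a⟩
  · simp [gadgetVoltage_none_of_mem he]
  · by_cases h : g = n e ∧ a = 0
    · obtain ⟨rfl, rfl⟩ := h
      simp [gadgetVoltage_some_of_mem he]
    · rw [gadgetVoltage_some (fun h' => h h'.2)]
      simp [shift_ne_zero]

/-- Distinct edges have distinct shifts and enter distinct gadgets; only edges that stay on sheet
`none` can agree. -/
lemma eq_of_gadgetVoltage_eq {e f : E} {i : Option (ι × (ι → ZMod 3))}
    (h : gadgetVoltage n R e i = gadgetVoltage n R f i) : e = f ∨ e ∉ R ∧ f ∉ R := by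
  rcases i with _ | ⟨g, a⟩
  · by_cases he : e ∈ R <;> by_cases hf : f ∈ R <;>
      simp_all [gadgetVoltage_none_of_mem, gadgetVoltage_none_of_notMem]
  · left
    by_cases he : e ∈ R ∧ g = n e ∧ a = 0 <;> by_cases hf : f ∈ R ∧ g = n f ∧ a = 0
    · exact n.injective (he.2.1.symm.trans hf.2.1)
    · rw [gadgetVoltage_some hf, he.2.1, he.2.2, gadgetVoltage_some_of_mem he.1] at h
      simp at h
    · rw [gadgetVoltage_some he, hf.2.1, hf.2.2, gadgetVoltage_some_of_mem hf.1] at h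
      simp at h
    · rw [gadgetVoltage_some he, gadgetVoltage_some hf] at h
      simp only [Option.some.injEq, Prod.mk.injEq, true_and, add_right_inj] at h
      exact shift_injective n h

lemma gadgetVoltage_gadgetVoltage_eq {e f : E} {i : Option (ι × (ι → ZMod 3))}
    (h : gadgetVoltage n R f (gadgetVoltage n R e i) = i) : e ∉ R ∧ f ∉ R := by
  rcases i with _ | ⟨g, a⟩
  · by_cases he : e ∈ R
    · rw [gadgetVoltage_none_of_mem he,
        gadgetVoltage_some (fun h' => shift_ne_zero n e h'.2.2)] at h
      simp at h
    · refine ⟨he, fun hf => ?_⟩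
      rw [gadgetVoltage_none_of_notMem he, gadgetVoltage_none_of_mem hf] at h
      simp at h
  · exfalso
    by_cases he : e ∈ R ∧ g = n e ∧ a = 0
    · obtain ⟨he, rfl, rfl⟩ := he
      rw [gadgetVoltage_some_of_mem he] at h
      by_cases hf : f ∈ R
      · rw [gadgetVoltage_none_of_mem hf] at h
        simp [shift_ne_zero] at h
      · rw [gadgetVoltage_none_of_notMem hf] at h
        simp at h
    · rw [gadgetVoltage_some he] at h
      by_cases hf : f ∈ R ∧ g = n f ∧ a + shift n e = 0
      · obtain ⟨hf, rfl, h0⟩ := hf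
        rw [h0, gadgetVoltage_some_of_mem hf] at h
        simp at h
      · rw [gadgetVoltage_some hf] at h
        simp [add_assoc, shift_add_shift_ne_zero] at h

lemma gadgetVoltage_eq_none_iff {e : E} {i : Option (ι × (ι → ZMod 3))} :
    gadgetVoltage n R e i = none ↔ e ∉ R ∧ i = none ∨ e ∈ R ∧ i = some (n e, 0) := by
  by_cases he : e ∈ R
  · rw [← gadgetVoltage_some_of_mem (n := n) he, (gadgetVoltage n R e).injective.eq_iff]
    simp [he]
  · nth_rw 1 [← gadgetVoltage_none_of_notMem (n := n) he]
    rw [(gadgetVoltage n R e).injective.eq_iff]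
    simp [he]

/-- Exactly two edges leave the gadget of `r`. -/
lemma gadgetVoltage_mem_gadget_iff {r e : E} (hr : r ∈ R) (i : Option (ι × (ι → ZMod 3))) :
    ¬ ((∃ a, i = some (n r, a)) ↔ ∃ a, gadgetVoltage n R e i = some (n r, a)) ↔
      e = r ∧ (i = none ∨ i = some (n r, 0)) := by
  rcases i with _ | ⟨g, a⟩
  · by_cases he : e ∈ R
    · rw [gadgetVoltage_none_of_mem he]
      simp
    · rw [gadgetVoltage_none_of_notMem he]
      simp only [reduceCtorEq, exists_false, not_true, true_or, and_true, false_iff]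
      rintro rfl
      exact he hr
  · by_cases he : e ∈ R ∧ g = n e ∧ a = 0
    · obtain ⟨he, rfl, rfl⟩ := he
      rw [gadgetVoltage_some_of_mem he]
      simp
    · rw [gadgetVoltage_some he]
      simp only [Option.some.injEq, Prod.mk.injEq, exists_and_left, exists_eq', and_true, iff_self,
        not_true, reduceCtorEq, false_or, false_iff]
      rintro ⟨rfl, h1, h2⟩
      exact he ⟨hr, h1, h2⟩

end Voltage

/-! ### Choice of the rerouted edges and projection of matchings -/

/-- A set of edges whose removal leaves a loopless graph without multiple edges, and which leaves
one edge of each class of parallel normal edges. -/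
lemma exists_reroutable_edges (G : Multigraph V E) :
    ∃ R : Set E, (∀ e, G.IsLoop e → e ∈ R) ∧
      (∀ e f, e ∉ R → f ∉ R → G.ends e = G.ends f → e = f) ∧
      ∀ e, ¬ G.IsLoop e → ∃ f, f ∉ R ∧ G.ends f = G.ends e := by
  obtain ⟨S, hS, hbij⟩ := Set.exists_subset_bijOn {e | ¬ G.IsLoop e} G.ends
  refine ⟨Sᶜ, fun e he heS => hS heS he, ?_, ?_⟩
  · intro e f he hf hef
    exact hbij.injOn (not_not.1 he) (not_not.1 hf) hef
  · intro e he
    obtain ⟨f, hf, hfe⟩ := hbij.surjOn ⟨e, he, rfl⟩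
    exact ⟨f, not_not.2 hf, hfe⟩

/-- A perfect matching of the gadget cover projects, on sheet `none`, to one of the base graph. -/
lemma isPerfectMatching_of_gadgetCover [DecidableEq ι] [Fintype E] {G : Multigraph V E}
    {s t : E → V} (h : ∀ e, G.ends e = .link s(s e, t e)) {n : E ↪ ι} {R : Set E}
    (hloop : ∀ e, G.IsLoop e → e ∈ R) {K : Set (V × Option (ι × (ι → ZMod 3)))}
    (hK : ∀ e i, (s e, i) ∈ K ↔ (t e, gadgetVoltage n R e i) ∈ K) (hbase : ∀ v, (v, none) ∈ K)
    [Fintype K] [Fintype {x : E × Option (ι × (ι → ZMod 3)) // (s x.1, x.2) ∈ K}]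
    (hcubic : (voltageCover s t (gadgetVoltage n R) K hK).IsCubic)
    {M : Set {x : E × Option (ι × (ι → ZMod 3)) // (s x.1, x.2) ∈ K}}
    (hM : (voltageCover s t (gadgetVoltage n R) K hK).IsPerfectMatching M) :
    G.IsPerfectMatching {e | (⟨(e, none), hbase (s e)⟩ : {x : E × _ // (s x.1, x.2) ∈ K}) ∈ M} := by
  classical
  have hends := voltageCover_ends hK
  have hmem : ∀ r ∈ R, (s r, some (n r, 0)) ∈ K := by
    intro r hr
    rw [hK, gadgetVoltage_some_of_mem hr]
    exact hbase _
  have hcut : ∀ r (hr : r ∈ R),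
      (⟨(r, none), hbase (s r)⟩ : {x : E × _ // (s x.1, x.2) ∈ K}) ∈ M ↔
        (⟨(r, some (n r, 0)), hmem r hr⟩ : {x : E × _ // (s x.1, x.2) ∈ K}) ∈ M := by
    intro r hr
    refine hM.mem_iff_mem_of_cut hends hcubic
      (Finset.univ.filter fun w : K => ∃ a, w.1.2 = some (n r, a)) (by simp) ?_
    rintro ⟨⟨e, i⟩, hx⟩
    simp only [Finset.mem_filter, Finset.mem_univ, true_and]
    rw [gadgetVoltage_mem_gadget_iff hr]
    simp only [Subtype.mk.injEq, Prod.mk.injEq]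
    tauto
  have hdown : ∀ e i (hx : (s e, i) ∈ K) v,
      (voltageCover s t (gadgetVoltage n R) K hK).Inc ⟨(e, i), hx⟩ ⟨(v, none), hbase v⟩ →
      (⟨(e, i), hx⟩ : {x : E × _ // (s x.1, x.2) ∈ K}) ∈ M →
      (⟨(e, none), hbase (s e)⟩ : {x : E × _ // (s x.1, x.2) ∈ K}) ∈ M ∧ G.Inc e v := by
    intro e i hx v hinc hxM
    rw [inc_iff_of_ends hends] at hinc
    rw [inc_iff_of_ends h]
    simp only [Subtype.mk.injEq, Prod.mk.injEq] at hinc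
    rcases hinc with ⟨hv, rfl⟩ | ⟨hv, hi⟩
    · exact ⟨hxM, .inl hv⟩
    · refine ⟨?_, .inr hv⟩
      rcases gadgetVoltage_eq_none_iff.1 hi with ⟨-, rfl⟩ | ⟨he, rfl⟩
      · exact hxM
      · exact (hcut e he).2 hxM
  have hup : ∀ e v, (⟨(e, none), hbase (s e)⟩ : {x : E × _ // (s x.1, x.2) ∈ K}) ∈ M →
      G.Inc e v → ∃ i, ∃ hx : (s e, i) ∈ K,
        (⟨(e, i), hx⟩ : {x : E × _ // (s x.1, x.2) ∈ K}) ∈ M ∧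
        (voltageCover s t (gadgetVoltage n R) K hK).Inc ⟨(e, i), hx⟩ ⟨(v, none), hbase v⟩ := by
    intro e v heM hinc
    simp only [inc_iff_of_ends hends, Subtype.mk.injEq, Prod.mk.injEq]
    rw [inc_iff_of_ends h] at hinc
    rcases hinc with hv | hv
    · exact ⟨none, hbase _, heM, .inl ⟨hv, rfl⟩⟩
    · by_cases he : e ∈ R
      · exact ⟨_, hmem e he, (hcut e he).1 heM, .inr ⟨hv, gadgetVoltage_some_of_mem he⟩⟩
      · exact ⟨none, hbase _, heM, .inr ⟨hv, gadgetVoltage_none_of_notMem he⟩⟩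
  refine ⟨?_, ?_⟩
  · intro e heM
    rw [isNormal_iff_of_ends h]
    intro hst
    have he := hloop e ((isLoop_iff_of_ends h e).2 hst)
    -- The crossed lifts of a loop both meet its vertex on sheet `none`, one by its source and the
    -- other by its target, so they cannot both be matched.
    have := (hM.2 ⟨(s e, none), hbase (s e)⟩).unique
      (y₁ := ⟨(e, none), hbase (s e)⟩) (y₂ := ⟨(e, some (n e, 0)), hmem e he⟩)
      ⟨heM, by simp [inc_iff_of_ends hends]⟩
      ⟨(hcut e he).1 heM, by
        simp [inc_iff_of_ends hends, gadgetVoltage_some_of_mem he, hst]⟩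
    simp at this
  · intro v
    obtain ⟨⟨⟨e, i⟩, hx⟩, ⟨hxM, hinc⟩, huniq⟩ := hM.2 ⟨(v, none), hbase v⟩
    refine ⟨e, hdown e i hx v hinc hxM, ?_⟩
    rintro f ⟨hfM, hfv⟩
    obtain ⟨j, hy, hyM, hyinc⟩ := hup f v hfM hfv
    have := huniq _ ⟨hyM, hyinc⟩
    simp only [Subtype.mk.injEq, Prod.mk.injEq] at this
    exact this.1

end Multigraph

open Multigraph

theorem mainTheorem9 {V : Type u} {E : Type v} [Fintype V] [Fintype E] (G : Multigraph V E)
    (hconn : G.Connected) (hcubic : G.IsCubic) (hsemi : ∀ e, ¬ G.IsSemi e)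
    (hpm : ¬ ∃ M, G.IsPerfectMatching M) :
    ∃ (W : Type u) (F : Type v) (_ : Fintype W) (_ : Fintype F) (H : Multigraph W F),
      H.Connected ∧ H.IsSimple ∧ H.Covers G ∧ ¬ ∃ M, H.IsPerfectMatching M := by
  classical
  obtain ⟨s, t, h⟩ := exists_orientation hsemi
  obtain ⟨R, hloop, hpar, hrep⟩ := G.exists_reroutable_edges
  -- Indexing by `Fin` instead of `E` keeps the vertices of the cover in `Type u`.
  let n : E ↪ Fin (Fintype.card E) := (Fintype.equivFin E).toEmbedding
  let σ := gadgetVoltage n R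
  obtain ⟨v₀⟩ := hconn.nonempty
  let C := (voltageGraph s t σ).connectedComponentMk (v₀, none)
  have hbase : ∀ v, (v, none) ∈ C.supp := by
    let φ : G.adjGraph →g voltageGraph s t σ :=
      { toFun := fun v => (v, none)
        map_rel' := by
          rintro a b ⟨hab, e, he⟩
          have hel : ¬ G.IsLoop e := by
            rintro ⟨w, hw⟩
            rw [he, EdgeEnds.link.injEq, Sym2.eq_iff] at hw
            apply hab
            rcases hw with ⟨h1, h2⟩ | ⟨h1, h2⟩ <;> exact h1.trans h2.symm
          obtain ⟨f, hf, hfe⟩ := hrep e hel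
          rw [he, h, EdgeEnds.link.injEq, Sym2.eq_iff] at hfe
          have hσ : σ f none = none := gadgetVoltage_none_of_notMem hf
          refine ⟨by simpa using hab, ?_⟩
          rcases hfe with ⟨rfl, rfl⟩ | ⟨rfl, rfl⟩
          · exact .inl ⟨f, none, rfl, by rw [hσ]⟩
          · exact .inr ⟨f, none, rfl, by rw [hσ]⟩ }
    intro v
    exact SimpleGraph.ConnectedComponent.sound ((hconn.preconnected v v₀).map φ)
  have hK := mem_supp_iff_of_voltageGraph C
  have hcover := voltageCover_isCoveringProjection hK h none hbase
  refine ⟨C.supp, {x : E × Option _ // (s x.1, x.2) ∈ C.supp}, inferInstance, inferInstance,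
    voltageCover s t σ C.supp hK, voltageCover_connected C, voltageCover_isSimple hK ?_ ?_ ?_,
    ⟨_, _, hcover⟩, ?_⟩
  · intro e i hst
    exact gadgetVoltage_ne_self (hloop e ((isLoop_iff_of_ends h e).2 hst)) i
  · intro e f i hs ht hi
    rcases eq_of_gadgetVoltage_eq hi with hef | ⟨he, hf⟩
    · exact hef
    · exact hpar e f he hf (by rw [h, h, hs, ht])
  · intro e f i hs ht hi
    obtain ⟨he, hf⟩ := gadgetVoltage_gadgetVoltage_eq hi
    have hef := hpar e f he hf (by rw [h, h, hs, ht, Sym2.eq_swap])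
    -- An edge antiparallel to itself is a loop, hence in `R`.
    subst hef
    exact he (hloop e ((isLoop_iff_of_ends h e).2 hs))
  · rintro ⟨M, hM⟩
    exact hpm ⟨_, isPerfectMatching_of_gadgetCover h hloop hK hbase
      (fun w => (hcover.degree_eq w).symm.trans (hcubic _)) hM⟩
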